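/- Let $J$ be a finite set and $\mathsf{A} = (A_i)_{i\in J}$ a tuple of real $2\times 2$ matrices. For a real $2\times2$ matrix $A$ let $\alpha_1(A)\ge\alpha_2(A)\ge 0$ be its singular values and let $\|A\| = \alpha_1(A)$ be the Euclidean operator norm. For $s \ge 0$ put $$\varphi^s(A)=\begin{cases}\alpha_1(A)^s, & 0\le s\le 1,\\ \alpha_1(A)\alpha_2(A)^{s-1}, & 1<s\le 2,\\ |\det A|^{s/2}, & s>2,\end{cases}\qquad 0^0=1.$$ For a word $\mathtt{i}=i_1\cdots i_n\in J^n$ write $A_{\mathtt i}=A_{i_1}\cdots A_{i_n}$. For a set $\Gamma\subset J^{\mathbb N}$ of infinite words that the left shift maps into itself, let $\Gamma_n \subset J^n$ be the set of prefixes of length $n$ of the words in $\Gamma$, and define the pressure $$P(\Gamma,\mathsf A,s)=\lim_{n\to\infty}\frac1n\log\sum_{\mathtt i\in\Gamma_n}\varphi^s(A_{\mathtt i})=\inf_{n\ge1}\frac1n\log\sum_{\mathtt i\in\Gamma_n}\varphi^s(A_{\mathtt i})\in[-\infty,\infty),$$ where $\log 0=-\infty$ (so the pressure of $\Gamma = \emptyset$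 is $-\infty$). Put $P(\mathsf A,s)=P(J^{\mathbb N},\mathsf A,s)$ and $I=\{i\in J: A_i \text{ is invertible}\}$. The tuple $\mathsf A$ is irreducible if there is no line $V$ through the origin of $\mathbb R^2$ with $A_iV\subset V$ for all $i\in J$. A multicone is a proper subset $\mathcal C\subsetneq\mathbb{RP}^1$ that is a union of finitely many, and at least one, closed projective intervals, none of them a single point or all of $\mathbb{RP}^1$. The tuple $\mathsf A$ is dominated if every $A_i$ is non-zero and there is a multicone $\mathcal C$ such that, for all $i\in J$ and all lines $V\in\mathcal C$, the image $A_iV$ is a line (not $\{0\}$) which belongs to the interior of $\mathcal C$. Lemma. Suppose that $\max_{i\in J}\|A_i\|<1$, that some $A_i$ has rank one, and that $\mathsf A$ is dominated or irreducible. Then $$P(I^{\mathbb N},\mathsf A,s)<P(\mathsf A,s)\qquad\text{for all } 0\le s\le1.$$ -/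

import Mathlib

open Filter Topology
open scoped ENNReal LinearAlgebra.Projectivization

namespace MatrixPressure

/-! ### Singular values and the singular value function -/

/-- The `k`-th (indexed from `0`) singular value of a `2 × 2` matrix, in non-increasing order:
the square root of the `k`-th eigenvalue of `Aᵀ A`. -/
noncomputable def singularValue (A : Matrix (Fin 2) (Fin 2) ℝ) (k : ℕ) : ℝ :=
  (Matrix.toEuclideanLin A).singularValues k

/-- The singular value function `φ^s(A)` for `s ≥ 0`. Real powers satisfy `0 ^ 0 = 1`. -/
noncomputable def svf (s : ℝ) (A : Matrix (Fin 2) (Fin 2) ℝ) : ℝ :=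
  if s ≤ 1 then singularValue A 0 ^ s
  else if s ≤ 2 then singularValue A 0 * singularValue A 1 ^ (s - 1)
  else |A.det| ^ (s / 2)

/-! ### Words and pressure -/

/-- The product `A_{i_1} ⋯ A_{i_n}` along a finite word. -/
def wordProd {J : Type*} (A : J → Matrix (Fin 2) (Fin 2) ℝ) {n : ℕ} (w : Fin n → J) :
    Matrix (Fin 2) (Fin 2) ℝ :=
  (List.ofFn fun k => A (w k)).prod

/-- `Γ_n`: the prefixes of length `n` of the infinite words in `Γ`. -/
def prefixes {J : Type*} (Γ : Set (ℕ → J)) (n : ℕ) : Set (Fin n → J) :=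
  {w | ∃ x ∈ Γ, ∀ k : Fin n, w k = x k}

open Classical in
/-- The sum of `φ^s(A_w)` over the words `w ∈ Γ_n`. -/
noncomputable def partitionSum {J : Type*} [Fintype J] (Γ : Set (ℕ → J))
    (A : J → Matrix (Fin 2) (Fin 2) ℝ) (s : ℝ) (n : ℕ) : ℝ≥0∞ :=
  ∑ w : Fin n → J with w ∈ prefixes Γ n, ENNReal.ofReal (svf s (wordProd A w))

/-- The pressure `P(Γ, A, s) = lim (1/n) log ∑_{w ∈ Γ_n} φ^s(A_w) ∈ [-∞, ∞)`, where `log 0 = -∞`.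
It is written as an upper limit so as to be defined at once; `tendsto_pressure` shows that it is a
limit, and `pressure_eq_iInf` that it is also the infimum over `n ≥ 1`, for all `Γ` which are
mapped into themselves by the left shift. -/
noncomputable def pressure {J : Type*} [Fintype J] (Γ : Set (ℕ → J))
    (A : J → Matrix (Fin 2) (Fin 2) ℝ) (s : ℝ) : EReal :=
  limsup (fun n : ℕ => ENNReal.log (partitionSum Γ A s n) / (n : EReal)) atTop

/-- `I^ℕ`: the infinite words all of whose letters carry invertible matrices. -/
def invertibleWords {J : Type*} (A : J → Matrix (Fin 2) (Fin 2) ℝ) : Set (ℕ → J) :=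
  {x | ∀ n, IsUnit (A (x n))}

/-! ### Irreducibility and domination -/

/-- The real projective line: the lines through the origin of the Euclidean plane. -/
abbrev RP1 : Type := ℙ ℝ (EuclideanSpace ℝ (Fin 2))

/-- The quotient topology from `ℝ² \ {0}`. -/
instance : TopologicalSpace RP1 :=
  inferInstanceAs (TopologicalSpace (Quotient (projectivizationSetoid ℝ (EuclideanSpace ℝ (Fin 2)))))

/-- No line `V` through the origin satisfies `A_i V ⊆ V` for all `i`. -/
def IsIrreducible {J : Type*} (A : J → Matrix (Fin 2) (Fin 2) ℝ) : Prop :=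
  ¬ ∃ V : RP1, ∀ i, V.submodule.map (Matrix.toEuclideanLin (A i)) ≤ V.submodule

theorem direction_ne_zero (θ : ℝ) : (!₂[Real.cos θ, Real.sin θ] : EuclideanSpace ℝ (Fin 2)) ≠ 0 := by
  intro h
  have h0 := congrArg (fun v : EuclideanSpace ℝ (Fin 2) => v 0) h
  have h1 := congrArg (fun v : EuclideanSpace ℝ (Fin 2) => v 1) h
  simp at h0 h1
  have := Real.cos_sq_add_sin_sq θ
  rw [h0, h1] at this
  norm_num at this

/-- The line through the origin in direction `(cos θ, sin θ)`. -/
noncomputable def line (θ : ℝ) : RP1 :=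
  Projectivization.mk ℝ !₂[Real.cos θ, Real.sin θ] (direction_ne_zero θ)

/-- A closed projective interval which is neither a point nor all of the projective line. -/
def IsClosedInterval (S : Set RP1) : Prop :=
  ∃ a b : ℝ, a < b ∧ b < a + Real.pi ∧ S = line '' Set.Icc a b

/-- A multicone: a proper subset which is a union of finitely many, and at least one, closed
non-trivial projective intervals. -/
def IsMulticone (C : Set RP1) : Prop :=
  C ≠ Set.univ ∧
    ∃ F : Set (Set RP1), F.Finite ∧ F.Nonempty ∧ (∀ S ∈ F, IsClosedInterval S) ∧ C = ⋃₀ F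

/-- `A_i C ⊆ C°` for all `i`: for every line `V ∈ C` the image `A_i V` is a line in the interior
of `C`; in particular `A_i V ≠ {0}`. -/
def IsStronglyInvariant {J : Type*} (A : J → Matrix (Fin 2) (Fin 2) ℝ) (C : Set RP1) : Prop :=
  ∀ i, ∀ V ∈ C, ∃ W ∈ interior C, V.submodule.map (Matrix.toEuclideanLin (A i)) = W.submodule

/-- All matrices are non-zero and there is a strongly invariant multicone. -/
def IsDominated {J : Type*} (A : J → Matrix (Fin 2) (Fin 2) ℝ) : Prop :=
  (∀ i, A i ≠ 0) ∧ ∃ C : Set RP1, IsMulticone C ∧ IsStronglyInvariant A C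

/-! ### The pressure is well defined -/

theorem singularValue_zero_eq_norm (A : Matrix (Fin 2) (Fin 2) ℝ) :
    singularValue A 0 = ‖Matrix.toEuclideanCLM (𝕜 := ℝ) A‖ := by
  set T : EuclideanSpace ℝ (Fin 2) →ₗ[ℝ] EuclideanSpace ℝ (Fin 2) := Matrix.toEuclideanLin A with hT
  have hTC : ∀ x, Matrix.toEuclideanCLM (𝕜 := ℝ) A x = T x := fun _ => rfl
  have hn : Module.finrank ℝ (EuclideanSpace ℝ (Fin 2)) = 2 := by simp
  have hσ0 : 0 ≤ T.singularValues 0 := T.singularValues_nonneg 0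
  have hsq : ∀ x, ‖T x‖ ^ 2 = inner ℝ ((LinearMap.adjoint T ∘ₗ T) x) x := fun x => by
    rw [LinearMap.comp_apply, LinearMap.adjoint_inner_left, real_inner_self_eq_norm_sq]
  have hS := T.isSymmetric_adjoint_comp_self
  let b := hS.eigenvectorBasis hn
  change T.singularValues 0 = _
  apply le_antisymm
  · have hb : ‖T (b 0)‖ ^ 2 = T.singularValues 0 ^ 2 := by
      rw [hsq, hS.apply_eigenvectorBasis hn 0, real_inner_smul_left,
        real_inner_self_eq_norm_sq, b.norm_eq_one]
      have := T.sq_singularValues_fin hn 0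
      simpa using this.symm
    have h1 : ‖T (b 0)‖ = T.singularValues 0 := by
      rwa [sq_eq_sq₀ (norm_nonneg _) hσ0] at hb
    have h2 := (Matrix.toEuclideanCLM (𝕜 := ℝ) A).le_opNorm (b 0)
    rwa [hTC, h1, b.norm_eq_one, mul_one] at h2
  · refine ContinuousLinearMap.opNorm_le_bound _ hσ0 fun x => ?_
    rw [hTC, ← sq_le_sq₀ (norm_nonneg _) (by positivity), mul_pow, hsq,
      ← b.sum_inner_mul_inner, ← real_inner_self_eq_norm_sq x, ← b.sum_inner_mul_inner,
      Finset.mul_sum]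
    refine Finset.sum_le_sum fun i _ => ?_
    have hi : inner ℝ ((LinearMap.adjoint T ∘ₗ T) x) (b i)
        = T.singularValues i ^ 2 * inner ℝ x (b i) := by
      rw [hS x (b i), hS.apply_eigenvectorBasis hn i, real_inner_smul_right,
        T.sq_singularValues_fin hn i]
      simp [b]
    have hle : T.singularValues i ^ 2 ≤ T.singularValues 0 ^ 2 :=
      pow_le_pow_left₀ (T.singularValues_nonneg i) (T.singularValues_antitone (Nat.zero_le i)) 2
    rw [hi, real_inner_comm x (b i), mul_assoc]
    gcongr
    exact mul_self_nonneg _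

theorem singularValue_mul (A : Matrix (Fin 2) (Fin 2) ℝ) :
    singularValue A 0 * singularValue A 1 = |A.det| := by
  have h := (Matrix.toEuclideanLin A).normDet_eq_prod_singularValues
  rw [LinearMap.normDet_eq_abs_det] at h
  have h2 : LinearMap.det (Matrix.toEuclideanLin A) = A.det := by
    simp [Matrix.toEuclideanLin_eq_toLin_orthonormal]
  rw [h2] at h
  rw [h]
  simp [singularValue, Finset.prod_range_succ]

theorem svf_nonneg (s : ℝ) (A : Matrix (Fin 2) (Fin 2) ℝ) : 0 ≤ svf s A := by
  have h0 : 0 ≤ singularValue A 0 := LinearMap.singularValues_nonneg _ _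
  have h1 : 0 ≤ singularValue A 1 := LinearMap.singularValues_nonneg _ _
  unfold svf
  split_ifs <;> positivity

theorem singularValue_zero_mul_le (A B : Matrix (Fin 2) (Fin 2) ℝ) :
    singularValue (A * B) 0 ≤ singularValue A 0 * singularValue B 0 := by
  simp only [singularValue_zero_eq_norm, map_mul]
  exact norm_mul_le _ _

theorem svf_mul_le {s : ℝ} (hs : 0 ≤ s) (A B : Matrix (Fin 2) (Fin 2) ℝ) :
    svf s (A * B) ≤ svf s A * svf s B := by
  have h0 : ∀ M, 0 ≤ singularValue M 0 := fun M => LinearMap.singularValues_nonneg _ _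
  have h1 : ∀ M, 0 ≤ singularValue M 1 := fun M => LinearMap.singularValues_nonneg _ _
  unfold svf
  split_ifs with hs1 hs2
  · rw [← Real.mul_rpow (h0 _) (h0 _)]
    exact Real.rpow_le_rpow (h0 _) (singularValue_zero_mul_le A B) hs
  · have key : ∀ M, singularValue M 0 * singularValue M 1 ^ (s - 1)
        = singularValue M 0 ^ (2 - s) * |M.det| ^ (s - 1) := by
      intro M
      rw [← singularValue_mul, Real.mul_rpow (h0 _) (h1 _), ← mul_assoc]
      rcases eq_or_lt_of_le (h0 M) with h | h
      · rw [← h, Real.zero_rpow (by linarith : s - 1 ≠ 0)]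
        simp
      · rw [← Real.rpow_add h]
        norm_num
    rw [key, key, key, Matrix.det_mul, abs_mul, Real.mul_rpow (abs_nonneg _) (abs_nonneg _)]
    have : singularValue (A * B) 0 ^ (2 - s)
        ≤ singularValue A 0 ^ (2 - s) * singularValue B 0 ^ (2 - s) := by
      rw [← Real.mul_rpow (h0 _) (h0 _)]
      exact Real.rpow_le_rpow (h0 _) (singularValue_zero_mul_le A B) (by linarith)
    calc _ ≤ (singularValue A 0 ^ (2 - s) * singularValue B 0 ^ (2 - s)) *
          (|A.det| ^ (s - 1) * |B.det| ^ (s - 1)) := by gcongr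
      _ = _ := by ring
  · rw [Matrix.det_mul, abs_mul, Real.mul_rpow (abs_nonneg _) (abs_nonneg _)]

theorem partitionSum_add_le {J : Type*} [Fintype J] {Γ : Set (ℕ → J)}
    (hΓ : ∀ x ∈ Γ, (fun n => x (n + 1)) ∈ Γ) (A : J → Matrix (Fin 2) (Fin 2) ℝ) {s : ℝ}
    (hs : 0 ≤ s) (m n : ℕ) :
    partitionSum Γ A s (m + n) ≤ partitionSum Γ A s m * partitionSum Γ A s n := by
  classical
  have hshift : ∀ (m : ℕ), ∀ x ∈ Γ, (fun n => x (m + n)) ∈ Γ := by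
    intro m
    induction m with
    | zero => intro x hx; simpa using hx
    | succ m ih =>
      intro x hx
      have := ih _ (hΓ x hx)
      convert this using 2
      congr 1
      omega
  unfold partitionSum
  rw [Finset.sum_mul_sum, ← Finset.sum_product']
  simp only [Finset.sum_filter, ← Finset.filter_product, Finset.univ_product_univ]
  rw [← (Fin.appendEquiv m n).sum_comp]
  refine Finset.sum_le_sum fun p _ => ?_
  obtain ⟨u, v⟩ := p
  by_cases h : Fin.append u v ∈ prefixes Γ (m + n)
  · obtain ⟨x, hx, hxw⟩ := h
    have hu : u ∈ prefixes Γ m := ⟨x, hx, fun k => by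
      have := hxw (Fin.castAdd n k); simpa using this⟩
    have hv : v ∈ prefixes Γ n := ⟨_, hshift m x hx, fun k => by
      have := hxw (Fin.natAdd m k); simpa using this⟩
    have hp : wordProd A (Fin.append u v) = wordProd A u * wordProd A v := by
      unfold wordProd
      rw [← List.prod_append, ← List.ofFn_fin_append]
      congr 2
      funext k
      refine Fin.addCases (fun i => ?_) (fun i => ?_) k <;> simp
    have hw : Fin.append u v ∈ prefixes Γ (m + n) := ⟨x, hx, hxw⟩
    simp only [Fin.appendEquiv, Equiv.coe_fn_mk, hw, hu, hv, if_true, and_self, hp]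
    rw [← ENNReal.ofReal_mul (svf_nonneg _ _)]
    exact ENNReal.ofReal_le_ofReal (svf_mul_le hs _ _)
  · simp [Fin.appendEquiv, h]

theorem partitionSum_ne_top {J : Type*} [Fintype J] (Γ : Set (ℕ → J))
    (A : J → Matrix (Fin 2) (Fin 2) ℝ) (s : ℝ) (n : ℕ) : partitionSum Γ A s n ≠ ∞ := by
  unfold partitionSum
  simp [ENNReal.sum_eq_top]

/-- Fekete's lemma for sub-multiplicative sequences in `[0, ∞)`, with limit in `[-∞, ∞)`. -/
theorem tendsto_log_div (u : ℕ → ℝ≥0∞) (hu : ∀ n, u n ≠ ∞) (hmul : ∀ m n, u (m + n) ≤ u m * u n) :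
    Tendsto (fun n : ℕ => ENNReal.log (u n) / (n : EReal)) atTop
      (𝓝 (⨅ n : {n : ℕ // 1 ≤ n}, ENNReal.log (u n) / ((n : ℕ) : EReal))) := by
  refine tendsto_order.2 ⟨fun a ha => ?_, fun a ha => ?_⟩
  · filter_upwards [eventually_ge_atTop 1] with n hn
    exact ha.trans_le (iInf_le (fun n : {n : ℕ // 1 ≤ n} =>
      ENNReal.log (u n) / ((n : ℕ) : EReal)) ⟨n, hn⟩)
  · obtain ⟨⟨n, hn⟩, hlt⟩ := iInf_lt_iff.1 ha
    simp only at hlt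
    by_cases hz : ∃ k, u k = 0
    · obtain ⟨k, hk⟩ := hz
      filter_upwards [eventually_ge_atTop (k + 1)] with p hp
      have h0 : u p = 0 := by
        have := hmul k (p - k)
        rw [hk, zero_mul, Nat.add_sub_cancel' (by omega)] at this
        exact le_antisymm this bot_le
      rw [h0, ENNReal.log_zero, EReal.bot_div_of_pos_ne_top (by
        exact_mod_cast (by omega : 0 < p)) (EReal.natCast_ne_top p)]
      exact bot_le.trans_lt hlt
    · push Not at hz
      have hpos : ∀ k, 0 < (u k).toReal := fun k => ENNReal.toReal_pos (hz k) (hu k)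
      have hcoe : ∀ k : ℕ, ENNReal.log (u k) / (k : EReal)
          = ((Real.log (u k).toReal / (k : ℝ) : ℝ) : EReal) := by
        intro k
        rw [ENNReal.log_pos_real (hz k) (hu k), EReal.coe_div]
        rfl
      have hsub : Subadditive fun k => Real.log (u k).toReal := by
        intro p q
        rw [← Real.log_mul (hpos p).ne' (hpos q).ne', ← ENNReal.toReal_mul]
        exact Real.log_le_log (hpos _)
          (ENNReal.toReal_mono (ENNReal.mul_ne_top (hu p) (hu q)) (hmul p q))
      rw [hcoe] at hlt
      obtain ⟨L, hL1, hL2⟩ := EReal.exists_between_coe_real hlt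
      have := hsub.eventually_div_lt_of_div_lt (by omega : n ≠ 0) (EReal.coe_lt_coe_iff.1 hL1)
      filter_upwards [this] with p hp
      rw [hcoe]
      exact (EReal.coe_lt_coe_iff.2 hp).trans hL2

theorem pressure_eq_iInf {J : Type*} [Fintype J] {Γ : Set (ℕ → J)}
    (hΓ : ∀ x ∈ Γ, (fun n => x (n + 1)) ∈ Γ) (A : J → Matrix (Fin 2) (Fin 2) ℝ) {s : ℝ}
    (hs : 0 ≤ s) :
    pressure Γ A s =
      ⨅ n : {n : ℕ // 1 ≤ n}, ENNReal.log (partitionSum Γ A s n) / ((n : ℕ) : EReal) :=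
  (tendsto_log_div _ (partitionSum_ne_top Γ A s) (partitionSum_add_le hΓ A hs)).limsup_eq

theorem tendsto_pressure {J : Type*} [Fintype J] {Γ : Set (ℕ → J)}
    (hΓ : ∀ x ∈ Γ, (fun n => x (n + 1)) ∈ Γ) (A : J → Matrix (Fin 2) (Fin 2) ℝ) {s : ℝ}
    (hs : 0 ≤ s) :
    Tendsto (fun n : ℕ => ENNReal.log (partitionSum Γ A s n) / (n : EReal)) atTop
      (𝓝 (pressure Γ A s)) := by
  rw [pressure_eq_iInf hΓ A hs]
  exact tendsto_log_div _ (partitionSum_ne_top Γ A s) (partitionSum_add_le hΓ A hs)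

end MatrixPressure

/-! For s ≤ 1 the function φ^s is f = ‖·‖^s. Let V_n be the sum of f(A_w) over all words w of length
n, and u_n the sum over the words with letters in I. Domination or irreducibility makes f
quasi-multiplicative: for products M, N of letters, f(M) f(N) is at most a constant times f(MN) +
Σ_i f(M A_i N). With sub-multiplicativity this gives e^{nP} ≤ V_n ≤ D e^{nP} for n ≥ 1, where P =
P(A, s) is finite.

Suppose P(I^ℕ, A, s) ≥ P, so that u_n ≥ e^{nP} for all n. Sort the words of length n + 1 by the
place b of their first letter outside I. A rank-one A_k is non-zero and k ∉ I, so appending it to an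
I-word costs a bounded factor: the words leaving I at place b or b + 1 carry a fixed proportion of
e^{nP}. Different b give disjoint sets of words, so V_{n+1} ≥ c n e^{nP}, against the upper bound.
This is `exists_wordSum_lt`.

Quasi-multiplicativity comes from compactness of the unit sphere in the irreducible case
(`exists_norm_mul_norm_le_of_inner_ne_zero`), and from a compact set of directions inside the
multicone in the dominated case (`IsDominated.exists_norm_mul_norm_le`). -/

namespace MatrixPressure

/-! ### Sums over words -/

/-- The sum of `f (M * a_{i_1} * ⋯ * a_{i_n})` over the words `i_1 ⋯ i_n` with letters in `t`. -/
noncomputable def wordSum {J R : Type*} [Monoid R] (f : R → ℝ) (a : J → R) (t : Finset J) :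
    ℕ → R → ℝ
  | 0, M => f M
  | n + 1, M => ∑ i ∈ t, wordSum f a t n (M * a i)

section WordSum

variable {J R : Type*} [Monoid R] {f g : R → ℝ} {a : J → R} {t : Finset J}

theorem wordSum_mono {H : Submonoid R} (ha : ∀ i, a i ∈ H) (hfg : ∀ M ∈ H, f M ≤ g M) (n : ℕ) :
    ∀ M ∈ H, wordSum f a t n M ≤ wordSum g a t n M := by
  induction n with
  | zero => exact hfg
  | succ n ih => exact fun M hM => Finset.sum_le_sum fun i _ => ih _ (H.mul_mem hM (ha i))

theorem wordSum_nonneg (hf : ∀ M, 0 ≤ f M) (n : ℕ) (M : R) : 0 ≤ wordSum f a t n M := by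
  induction n generalizing M with
  | zero => exact hf M
  | succ n ih => exact Finset.sum_nonneg fun i _ => ih _

theorem wordSum_add (n : ℕ) (M : R) :
    wordSum (fun M => f M + g M) a t n M = wordSum f a t n M + wordSum g a t n M := by
  induction n generalizing M with
  | zero => rfl
  | succ n ih => simp only [wordSum, ih, Finset.sum_add_distrib]

theorem wordSum_const_mul (c : ℝ) (n : ℕ) (M : R) :
    wordSum (fun M => c * f M) a t n M = c * wordSum f a t n M := by
  induction n generalizing M with
  | zero => rfl
  | succ n ih => simp only [wordSum, ih, Finset.mul_sum]

/-- The recursion peels off the first letter; here the last one is absorbed into the function. -/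
theorem wordSum_succ' (n : ℕ) (M : R) :
    wordSum f a t (n + 1) M = wordSum (fun M => ∑ i ∈ t, f (M * a i)) a t n M := by
  induction n generalizing M with
  | zero => rfl
  | succ n ih => exact Finset.sum_congr rfl fun i _ => ih _

theorem wordSum_mul_left (N : R) (n : ℕ) (M : R) :
    wordSum f a t n (N * M) = wordSum (fun M => f (N * M)) a t n M := by
  induction n generalizing M with
  | zero => rfl
  | succ n ih => simp only [wordSum, mul_assoc, ih]

theorem wordSum_comp {K : Type*} [Fintype K] (F : K → R → ℝ) (n : ℕ) (M : R) :
    wordSum (fun M => ∑ k, F k M) a t n M = ∑ k, wordSum (F k) a t n M := by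
  induction n generalizing M with
  | zero => rfl
  | succ n ih => simp only [wordSum, ih]; rw [Finset.sum_comm]

theorem wordSum_eq_sum [Fintype J] [DecidableEq J] (n : ℕ) (M : R) :
    wordSum f a t n M =
      ∑ w : Fin n → J, if ∀ k, w k ∈ t then f (M * (List.ofFn fun k => a (w k)).prod) else 0 := by
  induction n generalizing M with
  | zero => simp [wordSum]
  | succ n ih =>
    rw [← (Fin.consEquiv fun _ : Fin (n + 1) => J).sum_comp, Fintype.sum_prod_type, wordSum,
      ← Finset.sum_filter_add_sum_filter_not Finset.univ (· ∈ t)]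
    have h2 : ∀ x ∈ Finset.univ.filter (¬ · ∈ t), (∑ y : Fin n → J,
        if ∀ k, (Fin.consEquiv fun _ : Fin (n + 1) => J) (x, y) k ∈ t then
          f (M * (List.ofFn fun k => a ((Fin.consEquiv fun _ : Fin (n + 1) => J) (x, y) k)).prod)
          else 0) = 0 := by
      intro x hx
      refine Finset.sum_eq_zero fun y _ => if_neg fun h => ?_
      exact (Finset.mem_filter.1 hx).2 (by simpa using h 0)
    rw [Finset.sum_eq_zero h2, add_zero, Finset.filter_univ_mem]
    refine Finset.sum_congr rfl fun i hi => ?_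
    rw [ih]
    refine Finset.sum_congr rfl fun y _ => ?_
    simp [Fin.forall_fin_succ, List.ofFn_succ, hi, mul_assoc]

end WordSum

/-! ### Quasi-multiplicative functions and the growth gap -/

/-- `f` is a non-negative sub-multiplicative function which is multiplicative on a monoid
containing the letters `a i`, up to a constant and up to inserting at most one letter. -/
structure QuasiMultiplicative {J R : Type*} [Fintype J] [Monoid R] (f : R → ℝ) (a : J → R)
    (H : Submonoid R) (C : ℝ) : Prop where
  nonneg : ∀ M, 0 ≤ f M
  map_one : f 1 = 1
  mul_le : ∀ M N, f (M * N) ≤ f M * f N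
  letter_mem : ∀ i, a i ∈ H
  const_nonneg : 0 ≤ C
  le_mul : ∀ M ∈ H, ∀ N ∈ H, f M * f N ≤ C * (f (M * N) + ∑ i, f (M * a i * N))

namespace QuasiMultiplicative

variable {J R : Type*} [Fintype J] [Monoid R] {f : R → ℝ} {a : J → R}
  {H : Submonoid R} {C : ℝ}

theorem wordSum_succ_le (h : QuasiMultiplicative f a H C) (n : ℕ) (M : R) :
    wordSum f a Finset.univ (n + 1) M
      ≤ wordSum f a Finset.univ 1 1 * wordSum f a Finset.univ n M := by
  induction n generalizing M with
  | zero =>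
    simp only [wordSum, one_mul]
    rw [mul_comm, Finset.mul_sum]
    exact Finset.sum_le_sum fun i _ => h.mul_le _ _
  | succ n ih =>
    rw [wordSum, wordSum.eq_def f a _ (n + 1) M, Finset.mul_sum]
    exact Finset.sum_le_sum fun i _ => ih _

/-- Quasi-multiplicativity is summed over the words N of length n. The inserted letter produces a
sum over length n + 1, which `wordSum_succ_le` brings back to length n at the price of the factor
V_1. -/
theorem mul_wordSum_le (h : QuasiMultiplicative f a H C) (n : ℕ) {M : R} (hM : M ∈ H) :
    f M * wordSum f a Finset.univ n 1
      ≤ C * (1 + wordSum f a Finset.univ 1 1) * wordSum f a Finset.univ n M := by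
  have h1 : f M * wordSum f a Finset.univ n 1
      ≤ C * (wordSum f a Finset.univ n M + wordSum f a Finset.univ (n + 1) M) := by
    have e1 : wordSum f a Finset.univ n M = wordSum (fun N => f (M * N)) a Finset.univ n 1 := by
      rw [← wordSum_mul_left, mul_one]
    have e2 : wordSum f a Finset.univ (n + 1) M
        = wordSum (fun N => ∑ i, f (M * a i * N)) a Finset.univ n 1 := by
      rw [wordSum, wordSum_comp]
      refine Finset.sum_congr rfl fun i _ => ?_
      rw [← wordSum_mul_left, mul_one]
    rw [e1, e2, ← wordSum_add, ← wordSum_const_mul, ← wordSum_const_mul]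
    exact wordSum_mono h.letter_mem (fun N hN => h.le_mul M hM N hN) n 1 H.one_mem
  refine h1.trans ?_
  rw [mul_assoc, one_add_mul]
  have := h.wordSum_succ_le n M
  have := h.const_nonneg
  gcongr

theorem const_mul_nonneg (h : QuasiMultiplicative f a H C) :
    0 ≤ C * (1 + wordSum f a Finset.univ 1 1) :=
  mul_nonneg h.const_nonneg (add_nonneg zero_le_one (wordSum_nonneg h.nonneg _ _))

theorem wordSum_mul_wordSum_le (h : QuasiMultiplicative f a H C) (m n : ℕ) {M : R} (hM : M ∈ H) :
    wordSum f a Finset.univ m M * wordSum f a Finset.univ n 1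
      ≤ C * (1 + wordSum f a Finset.univ 1 1) * wordSum f a Finset.univ (m + n) M := by
  induction m generalizing M with
  | zero => simpa [wordSum] using h.mul_wordSum_le n hM
  | succ m ih =>
    rw [Nat.add_right_comm, wordSum, wordSum.eq_def f a _ (m + n + 1) M, Finset.sum_mul,
      Finset.mul_sum]
    exact Finset.sum_le_sum fun i _ => ih (H.mul_mem hM (h.letter_mem i))

variable {t : Finset J} [DecidableEq J]

/-- Words are sorted by the place b of their first letter outside t: b letters in t, one outside,
then n - 1 - b free letters. Words entirely in t are discarded. M is arbitrary in H because the
induction moves the first letter into it. -/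
theorem sum_wordSum_compl_mul_le (h : QuasiMultiplicative f a H C) (n : ℕ) {M : R} (hM : M ∈ H) :
    ∑ b ∈ Finset.range n, wordSum (fun N => ∑ l ∈ tᶜ, f (N * a l)) a t b M
        * wordSum f a Finset.univ (n - 1 - b) 1
      ≤ C * (1 + wordSum f a Finset.univ 1 1) * wordSum f a Finset.univ n M := by
  have hD := h.const_mul_nonneg
  have hmul := @h.mul_wordSum_le
  -- The constant is made opaque so that unfolding `wordSum` leaves the sum inside it alone.
  generalize C * (1 + wordSum f a Finset.univ 1 1) = D at hD hmul ⊢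
  induction n generalizing M with
  | zero => simpa using mul_nonneg hD (wordSum_nonneg h.nonneg _ _)
  | succ n ih =>
    rw [Finset.sum_range_succ', wordSum.eq_def f a _ (n + 1) M]
    simp only [wordSum]
    rw [← Finset.sum_add_sum_compl t, mul_add]
    refine add_le_add ?_ ?_
    · rw [Finset.mul_sum]
      simp only [Finset.sum_mul]
      rw [Finset.sum_comm]
      refine Finset.sum_le_sum fun i _ => (le_of_eq ?_).trans (ih (H.mul_mem hM (h.letter_mem i)))
      refine Finset.sum_congr rfl fun b hb => ?_
      rw [show n + 1 - 1 - (b + 1) = n - 1 - b by omega]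
    · rw [Finset.mul_sum, Finset.sum_mul]
      exact Finset.sum_le_sum fun i _ => hmul n (H.mul_mem hM (h.letter_mem i))

/-- The letter a_k is appended to a word N over t. Quasi-multiplicativity leads to N a_k, to N a_i
a_k with i ∈ t, or to N a_i a_k with i ∉ t. The first two leave t at places n and n + 1; in the
third a_k is split off by sub-multiplicativity, and N a_i leaves t at place n. -/
theorem mul_wordSum_le_compl (h : QuasiMultiplicative f a H C) {k : J} (hk : k ∉ t) (n : ℕ)
    {M : R} (hM : M ∈ H) :
    f (a k) * wordSum f a t n M ≤ C * (1 + f (a k)) *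
      (wordSum (fun N => ∑ l ∈ tᶜ, f (N * a l)) a t n M
        + wordSum (fun N => ∑ l ∈ tᶜ, f (N * a l)) a t (n + 1) M) := by
  rw [wordSum_succ', ← wordSum_add, ← wordSum_const_mul, ← wordSum_const_mul]
  refine wordSum_mono h.letter_mem (fun N hN => ?_) n M hM
  have hkc : k ∈ tᶜ := Finset.mem_compl.2 hk
  have h1 := h.le_mul N hN (a k) (h.letter_mem k)
  rw [mul_comm, mul_assoc]
  refine h1.trans (mul_le_mul_of_nonneg_left ?_ h.const_nonneg)
  rw [← Finset.sum_add_sum_compl t]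
  have e1 : f (N * a k) ≤ ∑ l ∈ tᶜ, f (N * a l) :=
    Finset.single_le_sum (f := fun l => f (N * a l)) (fun l _ => h.nonneg _) hkc
  have e2 : ∑ i ∈ t, f (N * a i * a k) ≤ ∑ i ∈ t, ∑ l ∈ tᶜ, f (N * a i * a l) :=
    Finset.sum_le_sum fun i _ =>
      Finset.single_le_sum (f := fun l => f (N * a i * a l)) (fun l _ => h.nonneg _) hkc
  have e3 : ∑ i ∈ tᶜ, f (N * a i * a k) ≤ f (a k) * ∑ l ∈ tᶜ, f (N * a l) := by
    rw [Finset.mul_sum]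
    exact Finset.sum_le_sum fun i _ => (h.mul_le _ _).trans_eq (mul_comm _ _)
  have e4 : 0 ≤ f (a k) * ∑ i ∈ t, ∑ l ∈ tᶜ, f (N * a i * a l) :=
    mul_nonneg (h.nonneg _) (Finset.sum_nonneg fun i _ => Finset.sum_nonneg fun l _ => h.nonneg _)
  linarith

/-- The words with letters in `t` cannot grow as fast as all words. -/
theorem exists_wordSum_lt (h : QuasiMultiplicative f a H C) {k : J} (hk : k ∉ t)
    (hfk : 0 < f (a k)) {ρ : ℝ} (hρ : 0 < ρ)
    (hlow : ∀ n, 1 ≤ n → ρ ^ n ≤ wordSum f a Finset.univ n 1)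
    (hup : ∀ n, 1 ≤ n → wordSum f a Finset.univ n 1
      ≤ C * (1 + wordSum f a Finset.univ 1 1) * ρ ^ n) :
    ∃ n, 1 ≤ n ∧ wordSum f a t n 1 < ρ ^ n := by
  by_contra! hu
  set D := C * (1 + wordSum f a Finset.univ 1 1) with hD
  set G : ℕ → ℝ := fun b => wordSum (fun N => ∑ l ∈ tᶜ, f (N * a l)) a t b 1 with hG
  have hD0 : 0 ≤ D := h.const_mul_nonneg
  have hG0 : ∀ b, 0 ≤ G b := fun b =>
    wordSum_nonneg (fun N => Finset.sum_nonneg fun l _ => h.nonneg _) _ _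
  have hu' : ∀ n, ρ ^ n ≤ wordSum f a t n 1 := fun n => by
    rcases n with _ | n
    · simp [wordSum, h.map_one]
    · exact hu _ (by omega)
  have hlow' : ∀ n, ρ ^ n ≤ wordSum f a Finset.univ n 1 := fun n => by
    rcases n with _ | n
    · simp [wordSum, h.map_one]
    · exact hlow _ (by omega)
  -- Comparing growth rates makes a linear function of n bounded, which is absurd.
  have key : ∀ n : ℕ, f (a k) * n ≤ C * (1 + f (a k)) * ((1 + ρ) * (D * D * ρ)) := by
    intro n
    -- Upper bound: the first-exit decomposition at length n + 1, with ρ^(n-b) below the sum over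
    -- the free letters.
    have h1 : ∑ b ∈ Finset.range (n + 1), G b * ρ ^ (n - b) ≤ D * D * ρ ^ (n + 1) := by
      calc _ ≤ ∑ b ∈ Finset.range (n + 1), G b * wordSum f a Finset.univ (n + 1 - 1 - b) 1 := by
            refine Finset.sum_le_sum fun b _ => ?_
            exact mul_le_mul_of_nonneg_left (hlow' _) (hG0 b)
        _ ≤ D * wordSum f a Finset.univ (n + 1) 1 :=
            h.sum_wordSum_compl_mul_le (n + 1) H.one_mem
        _ ≤ D * (D * ρ ^ (n + 1)) := mul_le_mul_of_nonneg_left (hup _ (by omega)) hD0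
        _ = _ := by ring
    -- Lower bound: since the t-sum at length b is at least ρ^b, each b contributes a multiple of
    -- ρ^n.
    have h2 : ∑ b ∈ Finset.range n, f (a k) * ρ ^ n ≤ ∑ b ∈ Finset.range n,
        C * (1 + f (a k)) * (G b * ρ ^ (n - b) + ρ * (G (b + 1) * ρ ^ (n - (b + 1)))) := by
      refine Finset.sum_le_sum fun b hb => ?_
      have hb := Finset.mem_range.1 hb
      have e := h.mul_wordSum_le_compl hk b H.one_mem
      have e2 : f (a k) * ρ ^ b ≤ C * (1 + f (a k)) * (G b + G (b + 1)) :=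
        (mul_le_mul_of_nonneg_left (hu' b) hfk.le).trans e
      have e3 := mul_le_mul_of_nonneg_right e2 (pow_pos hρ (n - b)).le
      rw [mul_assoc, ← pow_add, show b + (n - b) = n by omega] at e3
      refine e3.trans_eq ?_
      rw [show n - b = n - (b + 1) + 1 by omega, pow_succ]
      ring
    rw [← Finset.mul_sum (a := C * (1 + f (a k))), Finset.sum_add_distrib,
      ← Finset.mul_sum (a := ρ)] at h2
    have h3 : ∑ b ∈ Finset.range n, G b * ρ ^ (n - b) ≤
        ∑ b ∈ Finset.range (n + 1), G b * ρ ^ (n - b) := by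
      rw [Finset.sum_range_succ]
      exact le_add_of_nonneg_right (mul_nonneg (hG0 _) (pow_pos hρ _).le)
    have h4 : ∑ b ∈ Finset.range n, G (b + 1) * ρ ^ (n - (b + 1)) ≤
        ∑ b ∈ Finset.range (n + 1), G b * ρ ^ (n - b) := by
      rw [Finset.sum_range_succ']
      exact le_add_of_nonneg_right (mul_nonneg (hG0 _) (pow_pos hρ _).le)
    have h5 : f (a k) * n * ρ ^ n ≤ C * (1 + f (a k)) * ((1 + ρ) * (D * D * ρ)) * ρ ^ n := by
      have hc : 0 ≤ C * (1 + f (a k)) := mul_nonneg h.const_nonneg (by linarith)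
      calc f (a k) * n * ρ ^ n = ∑ b ∈ Finset.range n, f (a k) * ρ ^ n := by
            simp; ring
        _ ≤ _ := h2
        _ ≤ C * (1 + f (a k)) * (D * D * ρ ^ (n + 1) + ρ * (D * D * ρ ^ (n + 1))) := by
            gcongr
            · exact h3.trans h1
            · exact h4.trans h1
        _ = _ := by ring
    exact le_of_mul_le_mul_right h5 (pow_pos hρ n)
  obtain ⟨n, hn⟩ := exists_nat_gt (C * (1 + f (a k)) * ((1 + ρ) * (D * D * ρ)) / f (a k))
  rw [div_lt_iff₀ hfk, mul_comm (n : ℝ)] at hn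
  exact absurd (key n) (not_le.2 hn)

end QuasiMultiplicative

/-! ### Inequalities for operator norms -/

theorem sum_rpow_le {ι : Type*} (t : Finset ι) (x : ι → ℝ) (hx : ∀ i, 0 ≤ x i) {y s : ℝ}
    (hy : 0 ≤ y) (hs0 : 0 ≤ s) (hs1 : s ≤ 1) :
    (y + ∑ i ∈ t, x i) ^ s ≤ y ^ s + ∑ i ∈ t, x i ^ s := by
  classical
  induction t using Finset.induction_on with
  | empty => simp
  | insert i t hi ih =>
    rw [Finset.sum_insert hi, Finset.sum_insert hi, add_left_comm, add_left_comm (y ^ s)]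
    have h : 0 ≤ y + ∑ i ∈ t, x i := add_nonneg hy (Finset.sum_nonneg fun i _ => hx i)
    refine le_trans ?_ (add_le_add_right ih _)
    exact_mod_cast NNReal.rpow_add_le_add_rpow ⟨x i, hx i⟩ ⟨_, h⟩ hs0 hs1

section Norm

variable {J E : Type*} [Fintype J] [NormedAddCommGroup E]

/-- For 0 ≤ s ≤ 1 the power t ↦ t^s is monotone and subadditive, so the case s = 1 implies the
others. -/
theorem quasiMultiplicative_norm_rpow [NormedSpace ℝ E] [Nontrivial E] {a : J → E →L[ℝ] E}
    {H : Submonoid (E →L[ℝ] E)} (ha : ∀ i, a i ∈ H) {K : ℝ} (hK : 0 ≤ K)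
    (h : ∀ M ∈ H, ∀ N ∈ H, ‖M‖ * ‖N‖ ≤ K * (‖M * N‖ + ∑ i, ‖M * a i * N‖))
    {s : ℝ} (hs0 : 0 ≤ s) (hs1 : s ≤ 1) :
    QuasiMultiplicative (fun M => ‖M‖ ^ s) a H (K ^ s) where
  nonneg M := Real.rpow_nonneg (norm_nonneg _) _
  map_one := by simp
  mul_le M N := by
    rw [← Real.mul_rpow (norm_nonneg _) (norm_nonneg _)]
    exact Real.rpow_le_rpow (norm_nonneg _) (norm_mul_le _ _) hs0
  letter_mem := ha
  const_nonneg := Real.rpow_nonneg hK _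
  le_mul M hM N hN := by
    have h0 : 0 ≤ ‖M * N‖ + ∑ i, ‖M * a i * N‖ :=
      add_nonneg (norm_nonneg _) (Finset.sum_nonneg fun i _ => norm_nonneg _)
    rw [← Real.mul_rpow (norm_nonneg _) (norm_nonneg _)]
    refine (Real.rpow_le_rpow (by positivity) (h M hM N hN) hs0).trans ?_
    rw [Real.mul_rpow hK h0]
    exact mul_le_mul_of_nonneg_left
      (sum_rpow_le _ _ (fun i => norm_nonneg _) (norm_nonneg _) hs0 hs1) (Real.rpow_nonneg hK _)

/-- F is positive on the compact product of unit spheres, so by homogeneity F(x, y) ≥ c ‖x‖ ‖y‖ with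
c its minimum there. At the pair (N x, M* y) the terms of F become ⟨y, M N x⟩ and ⟨y, M a_i N x⟩;
suprema over x and then y give the norms. -/
theorem exists_norm_mul_norm_le_of_inner_ne_zero [InnerProductSpace ℝ E] [FiniteDimensional ℝ E]
    [Nontrivial E] (a : J → E →L[ℝ] E)
    (h : ∀ x y : E, x ≠ 0 → y ≠ 0 → inner ℝ y x ≠ 0 ∨ ∃ i, inner ℝ y (a i x) ≠ 0) :
    ∃ K : ℝ, 0 ≤ K ∧ ∀ M N : E →L[ℝ] E,
      ‖M‖ * ‖N‖ ≤ K * (‖M * N‖ + ∑ i, ‖M * a i * N‖) := by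
  let F : E × E → ℝ := fun p => |inner ℝ p.2 p.1| + ∑ i, |inner ℝ p.2 (a i p.1)|
  have hF : Continuous F := by fun_prop
  have hne : (Metric.sphere (0 : E) 1 ×ˢ Metric.sphere (0 : E) 1).Nonempty :=
    (NormedSpace.sphere_nonempty.2 zero_le_one).prod (NormedSpace.sphere_nonempty.2 zero_le_one)
  obtain ⟨p, hp, hmin⟩ := ((isCompact_sphere (0 : E) 1).prod
    (isCompact_sphere (0 : E) 1)).exists_isMinOn hne hF.continuousOn
  have hs : ∀ p : E × E, 0 ≤ ∑ i, |inner ℝ p.2 (a i p.1)| :=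
    fun p => Finset.sum_nonneg fun i _ => abs_nonneg _
  have hpos : 0 < F p := by
    rw [Set.mem_prod, mem_sphere_zero_iff_norm, mem_sphere_zero_iff_norm] at hp
    rcases h p.1 p.2 (norm_ne_zero_iff.1 (by simp [hp.1])) (norm_ne_zero_iff.1 (by simp [hp.2]))
      with h1 | ⟨i, hi⟩
    · exact add_pos_of_pos_of_nonneg (abs_pos.2 h1) (hs p)
    · exact add_pos_of_nonneg_of_pos (abs_nonneg _) (Finset.sum_pos'
        (fun i _ => abs_nonneg _) ⟨i, Finset.mem_univ _, abs_pos.2 hi⟩)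
  have hscale : ∀ x y : E, F p * (‖x‖ * ‖y‖) ≤ F (x, y) := by
    intro x y
    rcases eq_or_ne x 0 with rfl | hx
    · simp [F]
    rcases eq_or_ne y 0 with rfl | hy
    · simp [F]
    have hx' := norm_pos_iff.2 hx
    have hy' := norm_pos_iff.2 hy
    have h1 : F p ≤ F (‖x‖⁻¹ • x, ‖y‖⁻¹ • y) := hmin (by simp [norm_smul, hx, hy])
    have h2 : F (‖x‖⁻¹ • x, ‖y‖⁻¹ • y) = (‖x‖ * ‖y‖)⁻¹ * F (x, y) := by
      simp only [F, map_smul, real_inner_smul_left, real_inner_smul_right, abs_mul, abs_inv,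
        abs_norm, mul_add, Finset.mul_sum, mul_inv]
      congr 1
      · ring
      · exact Finset.sum_congr rfl fun i _ => by ring
    rw [h2, inv_mul_eq_div, le_div_iff₀ (by positivity)] at h1
    exact h1
  refine ⟨(F p)⁻¹, by positivity, fun M N => ?_⟩
  set B := ‖M * N‖ + ∑ i, ‖M * a i * N‖ with hB
  have hB0 : 0 ≤ B := add_nonneg (norm_nonneg _) (Finset.sum_nonneg fun i _ => norm_nonneg _)
  have hxy : ∀ x y : E, F p * (‖N x‖ * ‖M.adjoint y‖) ≤ B * (‖x‖ * ‖y‖) := by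
    intro x y
    refine (hscale _ _).trans ?_
    have hin : ∀ L : E →L[ℝ] E, |inner ℝ y (L x)| ≤ ‖L‖ * (‖x‖ * ‖y‖) := fun L =>
      (abs_real_inner_le_norm _ _).trans (by
        have := mul_le_mul_of_nonneg_left (L.le_opNorm x) (norm_nonneg y)
        linarith)
    simp only [F, ContinuousLinearMap.adjoint_inner_left, hB, add_mul, Finset.sum_mul]
    exact add_le_add (hin (M * N)) (Finset.sum_le_sum fun i _ => hin (M * a i * N))
  have hy : ∀ y : E, F p * ‖M.adjoint y‖ * ‖N‖ ≤ B * ‖y‖ := by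
    intro y
    have : ‖(F p * ‖M.adjoint y‖) • N‖ ≤ B * ‖y‖ := by
      refine ContinuousLinearMap.opNorm_le_bound _ (by positivity) fun x => ?_
      rw [smul_apply, norm_smul, Real.norm_of_nonneg (by positivity)]
      linarith [hxy x y]
    rwa [norm_smul, Real.norm_of_nonneg (by positivity)] at this
  have hMN : ‖(F p * ‖N‖) • M.adjoint‖ ≤ B := by
    refine ContinuousLinearMap.opNorm_le_bound _ hB0 fun y => ?_
    rw [smul_apply, norm_smul, Real.norm_of_nonneg (by positivity)]
    linarith [hy y]
  rw [norm_smul, Real.norm_of_nonneg (by positivity), LinearIsometryEquiv.norm_map] at hMN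
  rw [inv_mul_eq_div, le_div_iff₀ hpos]
  linarith

/-- A linear map which preserves a set of vectors away from the kernel of a functional does not
contract the vectors deep inside that set much more than any other vector. -/
theorem opNorm_mul_norm_le_of_mapsTo [NormedSpace ℝ E] {P : Set E} {l : E →L[ℝ] ℝ} {η δ : ℝ}
    (hη : 0 < η) (hδ : 0 < δ) (h0 : ∀ y ∈ P, y ≠ 0) (hl : ∀ y ∈ P, η * ‖y‖ ≤ |l y|)
    {M : E →L[ℝ] E} (hM : ∀ y ∈ P, M y ∈ P) {u : E}
    (hu : ∀ w, ‖w‖ ≤ δ * ‖u‖ → u + w ∈ P) :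
    ‖M‖ * ‖u‖ ≤ (1 + 2 * ‖l‖ / η) / δ * ‖M u‖ := by
  have huP : u ∈ P := by simpa using hu 0 (by simp; positivity)
  have hu0 : 0 < ‖u‖ := norm_pos_iff.2 (h0 u huP)
  have hx : ∀ x, ‖x‖ ≤ δ * ‖u‖ → ‖M x‖ ≤ (1 + 2 * ‖l‖ / η) * ‖M u‖ := by
    intro x hx
    -- Otherwise some u + τ x with |τ| ≤ 1 lies in P while its image lies in the kernel of l, which
    -- P avoids.
    have h1 : |l (M x)| ≤ |l (M u)| := by
      by_contra! hlt
      have hq : l (M x) ≠ 0 := fun h => by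
        rw [h, abs_zero] at hlt
        exact absurd hlt (not_lt.2 (abs_nonneg _))
      have hP : u + (-(l (M u) / l (M x))) • x ∈ P := by
        refine hu _ ?_
        rw [norm_smul, norm_neg, Real.norm_eq_abs, abs_div]
        refine (mul_le_of_le_one_left (norm_nonneg _) ?_).trans hx
        exact (div_le_one (abs_pos.2 hq)).2 hlt.le
      have h2 := hl _ (hM _ hP)
      have h3 := norm_pos_iff.2 (h0 _ (hM _ hP))
      have h4 : l (M (u + (-(l (M u) / l (M x))) • x)) = 0 := by
        simp only [map_add, map_smul, smul_eq_mul]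
        field_simp
        ring
      rw [h4, abs_zero] at h2
      exact absurd h2 (not_le.2 (by positivity))
    have h2 : η * ‖M u + M x‖ ≤ 2 * ‖l‖ * ‖M u‖ := by
      have := hl _ (hM _ (hu x hx))
      rw [map_add, map_add] at this
      have h3 := abs_add_le (l (M u)) (l (M x))
      have h4 := l.le_opNorm (M u)
      rw [Real.norm_eq_abs] at h4
      linarith
    have h3 : ‖M x‖ ≤ ‖M u + M x‖ + ‖M u‖ := by
      simpa using norm_sub_le (M u + M x) (M u)
    have h4 : ‖M u + M x‖ ≤ 2 * ‖l‖ / η * ‖M u‖ := by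
      rw [div_mul_eq_mul_div, le_div_iff₀ hη]
      linarith
    linarith
  have hop : ‖M‖ ≤ (1 + 2 * ‖l‖ / η) * ‖M u‖ / (δ * ‖u‖) := by
    refine ContinuousLinearMap.opNorm_le_bound _ (by positivity) fun x => ?_
    rcases eq_or_ne x 0 with rfl | hx0
    · simp
    have hx0' := norm_pos_iff.2 hx0
    have := hx ((δ * ‖u‖ / ‖x‖) • x) (by
      rw [norm_smul, Real.norm_of_nonneg (by positivity), div_mul_cancel₀ _ hx0'.ne'])
    rw [map_smul, norm_smul, Real.norm_of_nonneg (by positivity), div_mul_eq_mul_div,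
      div_le_iff₀ hx0'] at this
    rw [div_mul_eq_mul_div, le_div_iff₀ (by positivity)]
    linarith
  rw [le_div_iff₀ (by positivity)] at hop
  rw [div_mul_eq_mul_div, le_div_iff₀ hδ]
  linarith

end Norm

-- Cones of vectors over sets of lines

local notation "E2" => EuclideanSpace ℝ (Fin 2)

/-- The non-zero vectors which span a line in `C`. -/
def coneOver (C : Set RP1) : Set E2 := {v | ∃ h : v ≠ 0, Projectivization.mk ℝ v h ∈ C}

theorem smul_mem_coneOver {C : Set RP1} {v : E2} (hv : v ∈ coneOver C) {r : ℝ} (hr : r ≠ 0) :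
    r • v ∈ coneOver C := by
  obtain ⟨h, hC⟩ := hv
  refine ⟨smul_ne_zero hr h, ?_⟩
  convert hC using 1
  exact (Projectivization.mk_eq_mk_iff' ℝ _ _ _ _).2 ⟨r, rfl⟩

theorem isOpen_coneOver {C : Set RP1} (hC : IsOpen C) : IsOpen (coneOver C) := by
  have hq : Continuous (fun v : {v : E2 // v ≠ 0} => (Projectivization.mk ℝ v.1 v.2 : RP1)) :=
    continuous_quotient_mk'
  have ho : IsOpen {v : E2 | v ≠ 0} := isOpen_compl_singleton
  convert ho.isOpenMap_subtype_val _ (hC.preimage hq) using 1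
  ext v
  simp [coneOver]

theorem mem_coneOver_of_map_eq {v : E2} (hv : v ≠ 0) {T : E2 →ₗ[ℝ] E2} {C : Set RP1} {W : RP1}
    (hW : W ∈ C) (h : (Projectivization.mk ℝ v hv).submodule.map T = W.submodule) :
    T v ∈ coneOver C := by
  rw [Projectivization.submodule_mk, Submodule.map_span, Set.image_singleton] at h
  have h0 : T v ≠ 0 := by
    intro h0
    have := W.finrank_submodule
    rw [← h, h0, Submodule.span_zero_singleton, finrank_bot] at this
    omega
  refine ⟨h0, ?_⟩
  rw [← Projectivization.submodule_mk _ h0] at h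
  rwa [Projectivization.submodule_injective h]

/-- Compactness arguments can thus take place on angles in ℝ. -/
theorem IsMulticone.exists_isCompact {C : Set RP1} (hC : IsMulticone C) :
    ∃ Θ : Set ℝ, IsCompact Θ ∧ Θ.Nonempty ∧ C = line '' Θ := by
  obtain ⟨-, F, hF, ⟨S₀, hS₀⟩, hI, rfl⟩ := hC
  choose! a b hab _ hS using hI
  refine ⟨⋃ S ∈ F, Set.Icc (a S) (b S), hF.isCompact_biUnion fun S _ => isCompact_Icc,
    ⟨a S₀, Set.mem_biUnion hS₀ (Set.left_mem_Icc.2 (hab S₀ hS₀).le)⟩, ?_⟩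
  rw [Set.image_iUnion₂, Set.sUnion_eq_biUnion]
  exact Set.iUnion₂_congr hS

theorem exists_eq_smul_of_mem_coneOver {Θ : Set ℝ} {y : E2} (hy : y ∈ coneOver (line '' Θ)) :
    ∃ r : ℝ, r ≠ 0 ∧ ∃ θ ∈ Θ, y = r • !₂[Real.cos θ, Real.sin θ] := by
  obtain ⟨h, θ, hθ, he⟩ := hy
  obtain ⟨r, hr⟩ := (Projectivization.mk_eq_mk_iff' ℝ _ _ h (direction_ne_zero θ)).1 he.symm
  exact ⟨r, fun h0 => h (by rw [← hr, h0, zero_smul]), θ, hθ, hr.symm⟩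

theorem norm_direction (θ : ℝ) : ‖(!₂[Real.cos θ, Real.sin θ] : E2)‖ = 1 := by
  simp [EuclideanSpace.norm_eq, Fin.sum_univ_two]

theorem continuous_direction : Continuous fun θ : ℝ => (!₂[Real.cos θ, Real.sin θ] : E2) := by
  fun_prop

/-- A functional whose kernel is a line outside a multicone is bounded below on its cone. -/
theorem exists_functional_le {Θ : Set ℝ} (hΘ : IsCompact Θ) (hne : Θ.Nonempty)
    (huniv : line '' Θ ≠ Set.univ) :
    ∃ (l : E2 →L[ℝ] ℝ) (η : ℝ), 0 < η ∧ ∀ y ∈ coneOver (line '' Θ), η * ‖y‖ ≤ |l y| := by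
  obtain ⟨V, hV⟩ := (Set.ne_univ_iff_exists_notMem _).1 huniv
  induction V using Projectivization.ind with | h b hb =>
  -- l is the determinant against b, so its kernel is the line spanned by b, which is outside the
  -- multicone.
  let l : E2 →L[ℝ] ℝ := innerSL ℝ !₂[-b 1, b 0]
  have hl : ∀ y : E2, l y = b 0 * y 1 - b 1 * y 0 := fun y => by
    simp [l, PiLp.inner_apply, Fin.sum_univ_two]
    ring
  have hker : ∀ θ ∈ Θ, l !₂[Real.cos θ, Real.sin θ] ≠ 0 := by
    intro θ hθ h0
    apply hV
    refine ⟨θ, hθ, ?_⟩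
    refine ((Projectivization.mk_eq_mk_iff' ℝ _ _ _ _).2 ?_ : Projectivization.mk ℝ b hb = _).symm
    have hcs := Real.cos_sq_add_sin_sq θ
    have h0 : b 0 * Real.sin θ - b 1 * Real.cos θ = 0 := by simpa [hl] using h0
    refine ⟨b 0 * Real.cos θ + b 1 * Real.sin θ, ?_⟩
    ext i
    fin_cases i
    · simp
      linear_combination b 0 * hcs - Real.sin θ * h0
    · simp
      linear_combination b 1 * hcs + Real.cos θ * h0
  obtain ⟨θ₀, hθ₀, hmin⟩ := hΘ.exists_isMinOn hne
    ((l.continuous.comp continuous_direction).abs).continuousOn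
  refine ⟨l, _, abs_pos.2 (hker θ₀ hθ₀), fun y hy => ?_⟩
  obtain ⟨r, -, θ, hθ, rfl⟩ := exists_eq_smul_of_mem_coneOver hy
  rw [norm_smul, norm_direction, mul_one, map_smul, smul_eq_mul, abs_mul, mul_comm,
    Real.norm_eq_abs]
  exact mul_le_mul_of_nonneg_left (hmin hθ) (abs_nonneg r)

theorem svf_wordProd {J : Type*} {A : J → Matrix (Fin 2) (Fin 2) ℝ} {s : ℝ} (hs1 : s ≤ 1) {n : ℕ} (w : Fin n → J) :
    svf s (wordProd A w) =
      ‖1 * (List.ofFn fun k => Matrix.toEuclideanCLM (𝕜 := ℝ) (A (w k))).prod‖ ^ s := by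
  rw [svf, if_pos hs1, singularValue_zero_eq_norm, wordProd, map_list_prod, List.map_ofFn, one_mul]
  rfl

/-! ### Quasi-multiplicativity of dominated and irreducible tuples -/

variable {J : Type*} [Fintype J] {A : J → Matrix (Fin 2) (Fin 2) ℝ}

/-- After one letter, a vector of the cone lies uniformly deep inside it, and every product of
letters preserves such vectors. On them each product nearly attains its norm, so the estimate can be
applied to N at u and then to M at N u. -/
theorem IsDominated.exists_norm_mul_norm_le [Nonempty J] (hA : IsDominated A) :
    ∃ K : ℝ, 0 ≤ K ∧
      ∀ M ∈ Submonoid.closure (Set.range fun i => Matrix.toEuclideanCLM (𝕜 := ℝ) (A i)),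
      ∀ N ∈ Submonoid.closure (Set.range fun i => Matrix.toEuclideanCLM (𝕜 := ℝ) (A i)),
      ‖M‖ * ‖N‖ ≤ K * ‖M * N‖ := by
  obtain ⟨-, C, hC, hinv⟩ := hA
  obtain ⟨Θ, hΘ, hne, rfl⟩ := hC.exists_isCompact
  obtain ⟨l, η, hη, hl⟩ := exists_functional_le hΘ hne hC.1
  set P := coneOver (line '' Θ) with hP
  set T : J → E2 →L[ℝ] E2 := fun i => Matrix.toEuclideanCLM (𝕜 := ℝ) (A i) with hT
  have hTint : ∀ i, ∀ y ∈ P, T i y ∈ coneOver (interior (line '' Θ)) := by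
    rintro i y ⟨hy, hyC⟩
    obtain ⟨W, hW, h⟩ := hinv i _ hyC
    exact mem_coneOver_of_map_eq hy hW h
  have hsub : coneOver (interior (line '' Θ)) ⊆ P := fun y ⟨h, hy⟩ => ⟨h, interior_subset hy⟩
  have hdir : ∀ θ ∈ Θ, (!₂[Real.cos θ, Real.sin θ] : E2) ∈ P :=
    fun θ hθ => ⟨direction_ne_zero θ, θ, hθ, rfl⟩
  -- Q is a compact part of the open inner cone, so an ε-neighbourhood of it stays inside. Dividing
  -- by the bound B for the norms on Q makes this depth relative to the length of the vector.
  let Q : Set E2 := ⋃ i, (fun θ => T i !₂[Real.cos θ, Real.sin θ]) '' Θ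
  have hQc : IsCompact Q := isCompact_iUnion fun i =>
    hΘ.image ((T i).continuous.comp continuous_direction)
  have hQP : Q ⊆ coneOver (interior (line '' Θ)) := by
    rintro _ hq
    obtain ⟨i, θ, hθ, rfl⟩ := Set.mem_iUnion.1 hq
    exact hTint i _ (hdir θ hθ)
  obtain ⟨ε, hε, hεQ⟩ := hQc.exists_cthickening_subset_open (isOpen_coneOver isOpen_interior) hQP
  obtain ⟨B, hB0, hB⟩ := hQc.isBounded.exists_pos_norm_le
  have hδ : 0 < ε / B := div_pos hε hB0
  have hdeep : ∀ r : ℝ, r ≠ 0 → ∀ q ∈ Q, ∀ w, ‖w‖ ≤ ε / B * ‖r • q‖ → r • q + w ∈ P := by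
    intro r hr q hq w hw
    have hrw : r • q + w = r • (q + r⁻¹ • w) := by rw [smul_add, smul_inv_smul₀ hr]
    rw [hrw]
    refine smul_mem_coneOver (hsub (hεQ (Metric.mem_cthickening_of_dist_le _ q ε Q hq ?_))) hr
    rw [dist_eq_norm, add_sub_cancel_left, norm_smul, norm_inv]
    rw [norm_smul] at hw
    have hr' := norm_pos_iff.2 hr
    rw [inv_mul_le_iff₀ hr']
    calc ‖w‖ ≤ ε / B * (‖r‖ * ‖q‖) := hw
      _ ≤ ε / B * (‖r‖ * B) := by gcongr; exact hB q hq
      _ = ‖r‖ * ε := by field_simp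
  let H := Submonoid.closure (Set.range T)
  have hHP : ∀ M ∈ H, ∀ y ∈ P, M y ∈ P := by
    intro M hM
    induction hM using Submonoid.closure_induction with
    | mem M hM => obtain ⟨i, rfl⟩ := hM; exact fun y hy => hsub (hTint i y hy)
    | one => exact fun y hy => hy
    | mul M N _ _ h1 h2 => exact fun y hy => h1 _ (h2 y hy)
  -- Products change lengths, so invariance requires all non-zero multiples of Q.
  let good : Set E2 := {u | ∃ r : ℝ, r ≠ 0 ∧ ∃ q ∈ Q, u = r • q}
  have hgoodP : ∀ u ∈ good, u ∈ P := by
    rintro _ ⟨r, hr, q, hq, rfl⟩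
    exact smul_mem_coneOver (hsub (hQP hq)) hr
  have hHgood : ∀ M ∈ H, ∀ u ∈ good, M u ∈ good := by
    intro M hM
    induction hM using Submonoid.closure_induction with
    | mem M hM =>
      obtain ⟨i, rfl⟩ := hM
      intro u hu
      obtain ⟨r, hr, θ, hθ, rfl⟩ := exists_eq_smul_of_mem_coneOver (hgoodP u hu)
      exact ⟨r, hr, _, Set.mem_iUnion.2 ⟨i, θ, hθ, rfl⟩, map_smul _ _ _⟩
    | one => exact fun y hy => hy
    | mul M N _ _ h1 h2 => exact fun y hy => h1 _ (h2 y hy)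
  obtain ⟨u, hu⟩ : good.Nonempty := by
    obtain ⟨θ, hθ⟩ := hne
    exact ⟨_, 1, one_ne_zero, _, Set.mem_iUnion.2 ⟨Classical.arbitrary J, θ, hθ, rfl⟩, rfl⟩
  set K := (1 + 2 * ‖l‖ / η) / (ε / B) with hK
  have hK0 : 0 ≤ K := by positivity
  have hcone : ∀ M ∈ H, ∀ u ∈ good, ‖M‖ * ‖u‖ ≤ K * ‖M u‖ := by
    rintro M hM _ ⟨r, hr, q, hq, rfl⟩
    exact opNorm_mul_norm_le_of_mapsTo hη hδ (fun y hy => hy.1) hl (hHP M hM) (hdeep r hr q hq)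
  refine ⟨K * K, by positivity, fun M hM N hN => ?_⟩
  have hu0 : 0 < ‖u‖ := norm_pos_iff.2 (hgoodP u hu).1
  refine le_of_mul_le_mul_right ?_ hu0
  calc ‖M‖ * ‖N‖ * ‖u‖ = ‖M‖ * (‖N‖ * ‖u‖) := mul_assoc _ _ _
    _ ≤ ‖M‖ * (K * ‖N u‖) := mul_le_mul_of_nonneg_left (hcone N hN u hu) (norm_nonneg _)
    _ = K * (‖M‖ * ‖N u‖) := by ring
    _ ≤ K * (K * ‖M (N u)‖) := mul_le_mul_of_nonneg_left (hcone M hM _ (hHgood N hN u hu)) hK0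
    _ ≤ K * (K * (‖M * N‖ * ‖u‖)) := by gcongr; exact (M * N).le_opNorm u
    _ = K * K * ‖M * N‖ * ‖u‖ := by ring

/-- In the plane the orthogonal complement of y is a line. If it contained x and every A_i x, it
would be the line of x, and invariant. -/
theorem IsIrreducible.inner_ne_zero (hA : IsIrreducible A) (x y : E2) (hx : x ≠ 0) (hy : y ≠ 0) :
    inner ℝ y x ≠ 0 ∨ ∃ i, inner ℝ y (Matrix.toEuclideanCLM (𝕜 := ℝ) (A i) x) ≠ 0 := by
  by_contra! h
  obtain ⟨h0, hi⟩ := h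
  apply hA
  refine ⟨Projectivization.mk ℝ x hx, fun i => ?_⟩
  have : Fact (Module.finrank ℝ E2 = 1 + 1) := ⟨by simp⟩
  have hf : Module.finrank ℝ (ℝ ∙ y)ᗮ = 1 := Submodule.finrank_orthogonal_span_singleton hy
  have hxy : x ∈ (ℝ ∙ y)ᗮ := Submodule.mem_orthogonal_singleton_iff_inner_right.2 h0
  obtain ⟨c, hc⟩ := (finrank_eq_one_iff_of_nonzero' (⟨x, hxy⟩ : (ℝ ∙ y)ᗮ) (by simpa using hx)).1 hf
    ⟨_, Submodule.mem_orthogonal_singleton_iff_inner_right.2 (hi i)⟩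
  rw [Projectivization.submodule_mk, Submodule.map_span, Set.image_singleton,
    Submodule.span_singleton_le_iff_mem, Submodule.mem_span_singleton]
  exact ⟨c, congrArg Subtype.val hc⟩

theorem exists_quasiMultiplicative [Nonempty J] (hA : IsDominated A ∨ IsIrreducible A) {s : ℝ}
    (hs0 : 0 ≤ s) (hs1 : s ≤ 1) :
    ∃ C, QuasiMultiplicative (fun M : E2 →L[ℝ] E2 => ‖M‖ ^ s)
      (fun i => Matrix.toEuclideanCLM (𝕜 := ℝ) (A i))
      (Submonoid.closure (Set.range fun i => Matrix.toEuclideanCLM (𝕜 := ℝ) (A i))) C := by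
  suffices h : ∃ K : ℝ, 0 ≤ K ∧
      ∀ M ∈ Submonoid.closure (Set.range fun i => Matrix.toEuclideanCLM (𝕜 := ℝ) (A i)),
      ∀ N ∈ Submonoid.closure (Set.range fun i => Matrix.toEuclideanCLM (𝕜 := ℝ) (A i)),
      ‖M‖ * ‖N‖ ≤ K * (‖M * N‖ + ∑ i, ‖M * Matrix.toEuclideanCLM (𝕜 := ℝ) (A i) * N‖) by
    obtain ⟨K, hK, h⟩ := h
    exact ⟨K ^ s, quasiMultiplicative_norm_rpow
      (fun i => Submonoid.subset_closure (Set.mem_range_self i)) hK h hs0 hs1⟩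
  rcases hA with hA | hA
  · obtain ⟨K, hK, h⟩ := hA.exists_norm_mul_norm_le
    refine ⟨K, hK, fun M hM N hN => (h M hM N hN).trans (mul_le_mul_of_nonneg_left ?_ hK)⟩
    exact le_add_of_nonneg_right (Finset.sum_nonneg fun i _ => norm_nonneg _)
  · obtain ⟨K, hK, h⟩ := exists_norm_mul_norm_le_of_inner_ne_zero _ hA.inner_ne_zero
    exact ⟨K, hK, fun M _ N _ => h M N⟩

/-! ### Partition sums and pressure -/

theorem partitionSum_univ [Nonempty J] {s : ℝ} (hs1 : s ≤ 1) (n : ℕ) :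
    partitionSum Set.univ A s n = ENNReal.ofReal (wordSum (fun M : E2 →L[ℝ] E2 => ‖M‖ ^ s)
      (fun i => Matrix.toEuclideanCLM (𝕜 := ℝ) (A i)) Finset.univ n 1) := by
  classical
  rw [wordSum_eq_sum, ENNReal.ofReal_sum_of_nonneg
    (fun w _ => by split_ifs <;> positivity), partitionSum]
  have : ∀ w : Fin n → J, w ∈ prefixes Set.univ n := fun w =>
    ⟨fun k => if h : k < n then w ⟨k, h⟩ else Classical.arbitrary J, trivial, fun k => by simp⟩
  simp only [this, Finset.filter_true, Finset.mem_univ, implies_true, if_true, svf_wordProd hs1]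

-- Equality can fail: if no letter is invertible, there is no prefix even of length 0, while the
-- word sum at n = 0 is 1.
open Classical in
theorem partitionSum_invertibleWords_le {s : ℝ} (hs1 : s ≤ 1) (n : ℕ) :
    partitionSum (invertibleWords A) A s n ≤
      ENNReal.ofReal (wordSum (fun M : E2 →L[ℝ] E2 => ‖M‖ ^ s)
      (fun i => Matrix.toEuclideanCLM (𝕜 := ℝ) (A i)) {i | IsUnit (A i)} n 1) := by
  rw [wordSum_eq_sum, ENNReal.ofReal_sum_of_nonneg
    (fun w _ => by split_ifs <;> positivity), partitionSum, Finset.sum_filter]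
  refine Finset.sum_le_sum fun w _ => ?_
  split_ifs with h1 h2
  · rw [svf_wordProd hs1]
  · obtain ⟨x, hx, hw⟩ := h1
    exact absurd (fun k => by simpa [hw k] using hx k) h2
  all_goals exact bot_le

theorem pow_le_of_le_log_div {q x : ℝ} {n : ℕ} (hn : 1 ≤ n)
    (h : (q : EReal) ≤ ENNReal.log (ENNReal.ofReal x) / (n : EReal)) : Real.exp q ^ n ≤ x := by
  rw [EReal.le_div_iff_mul_le (by exact_mod_cast hn) (EReal.natCast_ne_top n)] at h
  by_contra! hlt
  have hpos : 0 < Real.exp q ^ n := pow_pos (Real.exp_pos q) n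
  have h1 := ENNReal.log_strictMono ((ENNReal.ofReal_lt_ofReal_iff hpos).2 hlt)
  rw [ENNReal.log_ofReal_of_pos hpos, Real.log_pow, Real.log_exp] at h1
  refine absurd (h.trans_lt h1) (not_lt.2 (le_of_eq ?_))
  rw [mul_comm, EReal.coe_mul]
  rfl

/-- The upper bound for almost super-multiplicative sequences. -/
theorem log_div_le_of_tendsto {V : ℕ → ℝ} {D : ℝ} (hD : 0 < D) (hV : ∀ n, 0 < V n)
    (h : ∀ m n, V m * V n ≤ D * V (m + n)) (hD1 : 1 ≤ D) {p : EReal}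
    (hp : Tendsto (fun n : ℕ => ENNReal.log (ENNReal.ofReal (V n)) / (n : EReal)) atTop (𝓝 p))
    {n : ℕ} (hn : 1 ≤ n) : ((Real.log (V n / D) / n : ℝ) : EReal) ≤ p := by
  -- Almost super-multiplicativity is iterated along the multiples of n, and the limit is then taken
  -- along them. The exponent k + 1 avoids length zero.
  have hpow : ∀ k : ℕ, (V n / D) ^ (k + 1) * D ≤ V (n * (k + 1)) := by
    intro k
    induction k with
    | zero => simp [div_mul_cancel₀ _ hD.ne']
    | succ k ih =>
      have h1 := h (n * (k + 1)) n
      have h2 : (V n / D) ^ (k + 1) * D * V n ≤ V (n * (k + 1)) * V n :=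
        mul_le_mul_of_nonneg_right ih (hV n).le
      have h3 : (V n / D) ^ (k + 1 + 1) * D * D = (V n / D) ^ (k + 1) * D * V n := by
        rw [pow_succ]
        field_simp
      rw [show n * (k + 1 + 1) = n * (k + 1) + n by ring]
      refine le_of_mul_le_mul_right ?_ hD
      linarith
  have hsub : Tendsto (fun k : ℕ => n * (k + 1)) atTop atTop :=
    tendsto_atTop_mono (fun k => k.le_succ.trans (Nat.le_mul_of_pos_left _ hn)) tendsto_id
  refine ge_of_tendsto' (hp.comp hsub) fun k => ?_
  have hn0 : (0 : ℝ) < n := by exact_mod_cast hn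
  have hq : 0 < V n / D := div_pos (hV n) hD
  rw [Function.comp_apply, ENNReal.log_ofReal_of_pos (hV _)]
  have : ((n * (k + 1) : ℕ) : EReal) = (((n * (k + 1) : ℕ) : ℝ) : EReal) := rfl
  rw [this, ← EReal.coe_div, EReal.coe_le_coe_iff, div_le_div_iff₀ hn0 (by positivity)]
  have h1 := Real.log_le_log (by positivity) (hpow k)
  rw [Real.log_mul (by positivity) hD.ne', Real.log_pow] at h1
  have h2 := Real.log_nonneg hD1
  push_cast at h1 ⊢
  nlinarith

end MatrixPressure

/-! ### Proof of the strict inequality -/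

open MatrixPressure

theorem mainTheorem3 {J : Type*} [Fintype J] (A : J → Matrix (Fin 2) (Fin 2) ℝ)
    (hcontr : ∀ i, ‖Matrix.toEuclideanCLM (𝕜 := ℝ) (A i)‖ < 1)
    (hrank : ∃ k, (A k).rank = 1)
    (hdi : MatrixPressure.IsDominated A ∨ MatrixPressure.IsIrreducible A)
    (s : ℝ) (hs0 : 0 ≤ s) (hs1 : s ≤ 1) :
    MatrixPressure.pressure (MatrixPressure.invertibleWords A) A s
      < MatrixPressure.pressure Set.univ A s := by
  classical
  obtain ⟨k, hk⟩ := hrank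
  have : Nonempty J := ⟨k⟩
  obtain ⟨C, hQ⟩ := exists_quasiMultiplicative hdi hs0 hs1
  have hkI : k ∉ ({i | IsUnit (A i)} : Finset J) := by
    intro h
    have := Matrix.rank_of_isUnit (A k) (Finset.mem_filter.1 h).2
    simp [hk] at this
  have hk0 : A k ≠ 0 := fun h => by simp [h] at hk
  have hfk : 0 < ‖Matrix.toEuclideanCLM (𝕜 := ℝ) (A k)‖ ^ s :=
    Real.rpow_pos_of_pos (norm_pos_iff.2 ((map_ne_zero_iff _
      (Matrix.toEuclideanCLM (𝕜 := ℝ) (n := Fin 2)).injective).2 hk0)) _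
  set a := fun i => Matrix.toEuclideanCLM (𝕜 := ℝ) (A i) with ha
  set f := fun M : EuclideanSpace ℝ (Fin 2) →L[ℝ] EuclideanSpace ℝ (Fin 2) => ‖M‖ ^ s with hf
  set V : ℕ → ℝ := fun n => wordSum f a Finset.univ n 1 with hV
  set D := C * (1 + wordSum f a Finset.univ 1 1) with hD
  have hD0 : 0 ≤ D := hQ.const_mul_nonneg
  have hVV : ∀ m n, V m * V n ≤ D * V (m + n) := fun m n =>
    hQ.wordSum_mul_wordSum_le m n (one_mem _)
  have hV0 : V 0 = 1 := hQ.map_one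
  have hV1 : 0 < V 1 := by
    simp only [hV, wordSum, one_mul]
    exact Finset.sum_pos' (fun i _ => hQ.nonneg _) ⟨k, Finset.mem_univ _, hfk⟩
  have hD1 : 1 ≤ D := by simpa [hV0] using hVV 0 0
  have hVpos : ∀ n, 0 < V n := by
    intro n
    induction n with
    | zero => rw [hV0]; exact one_pos
    | succ n ih => exact pos_of_mul_pos_right ((mul_pos ih hV1).trans_le (hVV n 1)) hD0
  have hps : ∀ n, partitionSum Set.univ A s n = ENNReal.ofReal (V n) := partitionSum_univ hs1
  have hlim := tendsto_pressure (Γ := Set.univ) (fun _ _ => trivial) A hs0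
  have hinf := pressure_eq_iInf (Γ := Set.univ) (fun _ _ => trivial) A hs0
  simp only [hps] at hlim hinf
  have hlower : ∀ n, 1 ≤ n → ((Real.log (V n / D) / n : ℝ) : EReal) ≤ pressure Set.univ A s :=
    fun n hn => log_div_le_of_tendsto (one_pos.trans_le hD1) hVpos hVV hD1 hlim hn
  have hupper : ∀ n : ℕ, 1 ≤ n →
      pressure Set.univ A s ≤ ENNReal.log (ENNReal.ofReal (V n)) / (n : EReal) := fun n hn => by
    rw [hinf]
    exact iInf_le (fun n : {n : ℕ // 1 ≤ n} =>
      ENNReal.log (ENNReal.ofReal (V n)) / ((n : ℕ) : EReal)) ⟨n, hn⟩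
  -- The pressure of all words is finite, so its exponential is a positive real rate ρ.
  have hbot : pressure Set.univ A s ≠ ⊥ :=
    ((EReal.bot_lt_coe _).trans_le (hlower 1 le_rfl)).ne'
  have htop : pressure Set.univ A s ≠ ⊤ := by
    refine ((hupper 1 le_rfl).trans_lt ?_).ne
    rw [ENNReal.log_ofReal_of_pos hV1]
    simp
  by_contra! hle
  lift pressure Set.univ A s to ℝ using ⟨htop, hbot⟩ with q
  obtain ⟨n, hn, hlt⟩ := hQ.exists_wordSum_lt hkI hfk (Real.exp_pos q)
    (fun n hn => pow_le_of_le_log_div hn (hupper n hn)) (fun n hn => by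
      have h := EReal.coe_le_coe_iff.1 (hlower n hn)
      have hn0 : (0 : ℝ) < n := by exact_mod_cast hn
      rw [div_le_iff₀ hn0, Real.log_le_iff_le_exp (div_pos (hVpos n) (one_pos.trans_le hD1)),
        div_le_iff₀ (one_pos.trans_le hD1), mul_comm q, Real.exp_nat_mul] at h
      linarith)
  -- The pressure of I^ℕ is an infimum over n, so a single length n at which the I-sum drops below
  -- e^{nq} gives the contradiction.
  refine absurd (pow_le_of_le_log_div hn (hle.trans ?_)) (not_le.2 hlt)
  rw [pressure_eq_iInf (Γ := invertibleWords A) (fun x hx n => hx (n + 1)) A hs0]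
  refine (iInf_le (fun n : {n : ℕ // 1 ≤ n} => ENNReal.log
    (partitionSum (invertibleWords A) A s n) / ((n : ℕ) : EReal)) ⟨n, hn⟩).trans ?_
  exact EReal.div_le_div_right_of_nonneg (by positivity)
    (ENNReal.log_le_log (partitionSum_invertibleWords_le hs1 n))
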